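/- Let $\mathcal G$ be a strongly connected weighted directed graph on the nodes $\{1,\dots,n\}$, without self-loops, with weights $a_{ij}>0$ if there is an edge from $j$ to $i$ and $a_{ij}=0$ otherwise. Let $d_i=\sum_j a_{ij}$, let $\mathbf L=\mathrm{diag}(d_1,\dots,d_n)-[a_{ij}]$ be the Laplacian, and let $\boldsymbol\omega$ be the left null vector of $\mathbf L$ ($\boldsymbol\omega^T\mathbf L=\mathbf 0$) with $\mathbf 1^T\boldsymbol\omega=1$. Let $\alpha>0$ with $\alpha d_i<1$ for all $i$, let $\Delta>0$, $\kappa\ge 0$ be real and $k_0\ge 0$ an integer, and put $\mathbf Q=\mathbf I-\alpha\mathbf L-\mathbf 1\boldsymbol\omega^T$. Let the random matrices $\mathbf Z(t)=[z_{il}(t)]_{n\times n}$ satisfy $\mathbf Z(0)=n^{\kappa}\mathbf I$ and $$z_{il}(t+1)=z_{il}(t)+\alpha\sum_{j}a_{ij}\bigl[\mathcal Q(z_{jl}(t))-\mathcal Q(z_{il}(t))\bigr],\qquad t\ge 0,$$ where the quantized values $\mathcal Q(z_{il}(t))$ are of one of the following two kinds. (a) $\mathcal Q$ is the probabilistic quantizer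 with step size $\Delta$: $\mathcal Q(x)=\lceil x/\Delta\rceil\Delta$ with probability $p=x/\Delta-\lfloor x/\Delta\rfloor$ and $\mathcal Q(x)=\lfloor x/\Delta\rfloor\Delta$ with probability $1-p$; the randomizations that it uses are independent of the data, and independent over all times and nodes. (b) The quantization errors $u_{il}(t)=\mathcal Q(z_{il}(t))-z_{il}(t)$ satisfy $\mathbb E\,u_{il}(t)=0$ and $\mathbb E\,u_{il}(t)^2\le\Delta^2/4$, and the error vectors $(u_{i1}(t),\dots,u_{in}(t))$ are independent over all times $t$ and nodes $i$. For $K\ge 1$ let $\bar{\mathbf Z}(K)=\frac{1}{n^{\kappa}K}\sum_{k=k_0+1}^{k_0+K}\mathbf Z(k)$. Then $\mathbf I-\mathbf Q$ is invertible, $\|\bar{\mathbf Z}(K)-\mathbf 1\boldsymbol\omega^T\|_F^2$ is integrable for every $K$, and $\bar{\mathbf Z}(K)$ converges to $\mathbf 1\boldsymbol\omega^T$ in mean square, that is, $\mathbb E\|\bar{\mathbf Z}(K)-\mathbf 1\boldsymbol\omega^T\|_F^2\to 0$ as $K\to\infty$. Moreover $$\mathbb E\bigl\{\|\bar{\mathbf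 Z}(K)-\mathbf 1\boldsymbol\omega^T\|_F^2\bigr\}\le\frac{n\nu^2}{4}\,\frac1K+o\Bigl(\frac1K\Bigr)\quad(K\to\infty),\qquad \nu=\alpha\sqrt{n+2}\,\Delta\,\bigl\|(\mathbf I-\mathbf Q)^{-1}\mathbf L\bigr\|_2 .$$ -/

import Mathlib

open MeasureTheory ProbabilityTheory Filter Asymptotics

/-- A weighted directed graph on the nodes `Fin n` without self-loops. The weight `A i j` is
positive exactly when there is an edge from `j` to `i` (node `i` receives data from node `j`),
and it is zero otherwise. -/
structure WeightedDigraph (n : ℕ) where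
  A : Matrix (Fin n) (Fin n) ℝ
  nonneg : ∀ i j, 0 ≤ A i j
  no_loops : ∀ i, A i i = 0

namespace WeightedDigraph

variable {n : ℕ} (G : WeightedDigraph n)

/-- There is a directed edge from `j` to `i`. -/
def Edge (j i : Fin n) : Prop := 0 < G.A i j

/-- Any two nodes are joined by a directed path. -/
def StronglyConnected : Prop := ∀ i j, Relation.ReflTransGen G.Edge i j

/-- The in-degree `d i` of the node `i`. -/
def deg (i : Fin n) : ℝ := ∑ j, G.A i j

/-- The Laplacian `L = D - A`. -/
def lap : Matrix (Fin n) (Fin n) ℝ := Matrix.diagonal G.deg - G.A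

/-- `w` is the left eigenvector of the Laplacian for the eigenvalue `0`, with entries summing
to `1`. -/
def IsNormalizedLeftNullVector (w : Fin n → ℝ) : Prop :=
  Matrix.vecMul w G.lap = 0 ∧ ∑ i, w i = 1

/-- The matrix `Q = I - α L - 1 wᵀ`. -/
def qMatrix (α : ℝ) (w : Fin n → ℝ) : Matrix (Fin n) (Fin n) ℝ :=
  (1 - α • G.lap) - Matrix.vecMulVec (fun _ => 1) w

/-- A run of the quantized Laplacian iteration. `Z t ω` is the matrix of states, whose `i`-th row
is the vector held by node `i` at time `t`, and `q t ω` is the matrix of the quantized values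
`𝒬(z_ij(t))` which the nodes send. The initial state is `n ^ κ` times the identity. -/
structure IsQuantizedIteration {Ω : Type*} (α κ : ℝ)
    (Z q : ℕ → Ω → Matrix (Fin n) (Fin n) ℝ) : Prop where
  init : ∀ ω, Z 0 ω = ((n : ℝ) ^ κ) • (1 : Matrix (Fin n) (Fin n) ℝ)
  step : ∀ t ω i l,
    Z (t + 1) ω i l = Z t ω i l + α * ∑ j, G.A i j * (q t ω j l - q t ω i l)

end WeightedDigraph

/-- The probabilistic quantizer with step size `Δ`, driven by a number `ξ`. When `ξ` is uniform
on `[0, 1]`, the value is `⌈x / Δ⌉ Δ` with probability `p = x / Δ - ⌊x / Δ⌋`, and it is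
`⌊x / Δ⌋ Δ` with probability `1 - p`. -/
noncomputable def probQuantize (Δ ξ x : ℝ) : ℝ :=
  if ξ < x / Δ - ⌊x / Δ⌋ then (⌈x / Δ⌉ : ℝ) * Δ else (⌊x / Δ⌋ : ℝ) * Δ

/-- The messages `q` are produced from the states `Z` by the probabilistic quantizer with step
size `Δ`, applied entrywise. The randomization used by node `i` at time `t` is the vector `ξ t i`;
these vectors are independent over all times and nodes (so they are also independent of the data
that has to be quantized), and each of their entries is uniform on `[0, 1]`. -/
def IndependentProbabilisticQuantization {n : ℕ} {Ω : Type*} [MeasurableSpace Ω] (μ : Measure Ω)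
    (Δ : ℝ) (Z q : ℕ → Ω → Matrix (Fin n) (Fin n) ℝ) : Prop :=
  ∃ ξ : ℕ → Fin n → Fin n → Ω → ℝ,
    (∀ t i l, Measurable (ξ t i l)) ∧
    (∀ t i l, μ.map (ξ t i l) = volume.restrict (Set.Icc 0 1)) ∧
    iIndepFun (fun (p : ℕ × Fin n) (ω : Ω) (l : Fin n) => ξ p.1 p.2 l ω) μ ∧
    ∀ t ω i l, q t ω i l = probQuantize Δ (ξ t i l ω) (Z t ω i l)

/-- The quantization errors `u t = q t - Z t` are unbiased with variance at most `Δ ^ 2 / 4`, and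
the error vectors (rows) of the nodes are independent over all times and nodes. As the initial
state is deterministic, the errors at time `t` are then independent of the data up to time `t`. -/
def IndependentQuantizationErrors {n : ℕ} {Ω : Type*} [MeasurableSpace Ω] (μ : Measure Ω)
    (Δ : ℝ) (Z q : ℕ → Ω → Matrix (Fin n) (Fin n) ℝ) : Prop :=
  (∀ t i l, MemLp (fun ω => q t ω i l - Z t ω i l) 2 μ) ∧
  (∀ t i l, ∫ ω, (q t ω i l - Z t ω i l) ∂μ = 0) ∧
  (∀ t i l, ∫ ω, (q t ω i l - Z t ω i l) ^ 2 ∂μ ≤ Δ ^ 2 / 4) ∧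
  iIndepFun (fun (p : ℕ × Fin n) (ω : Ω) (l : Fin n) => q p.1 ω p.2 l - Z p.1 ω p.2 l) μ

/-- The running average of the states at the times `k₀ + 1, …, k₀ + K`, rescaled by `n ^ (-κ)` to
undo the scaling of the initial state. -/
noncomputable def runningAverage {n : ℕ} {Ω : Type*} (κ : ℝ) (k₀ : ℕ)
    (Z : ℕ → Ω → Matrix (Fin n) (Fin n) ℝ) (K : ℕ) (ω : Ω) : Matrix (Fin n) (Fin n) ℝ :=
  ((n : ℝ) ^ κ)⁻¹ • ((K : ℝ)⁻¹ • ∑ k ∈ Finset.Icc (k₀ + 1) (k₀ + K), Z k ω)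

/-- The Euclidean operator norm of a square matrix. -/
noncomputable def spectralNorm₂ {n : ℕ} (M : Matrix (Fin n) (Fin n) ℝ) : ℝ :=
  ‖Matrix.toEuclideanCLM (n := Fin n) (𝕜 := ℝ) M‖

section
attribute [local instance] Matrix.frobeniusNormedAddCommGroup

/-- The Frobenius norm of a square matrix. -/
noncomputable def frobeniusNorm {n : ℕ} (M : Matrix (Fin n) (Fin n) ℝ) : ℝ := ‖M‖

end

/-- The squared Frobenius norm of the error of the running average as an estimate of `1 wᵀ`. -/
noncomputable def sqError {n : ℕ} {Ω : Type*} (κ : ℝ) (k₀ : ℕ) (w : Fin n → ℝ)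
    (Z : ℕ → Ω → Matrix (Fin n) (Fin n) ℝ) (K : ℕ) (ω : Ω) : ℝ :=
  frobeniusNorm (runningAverage κ k₀ Z K ω - Matrix.vecMulVec (fun _ => 1) w) ^ 2

/-- The constant `ν = α √(n + 2) Δ ‖(I - Q)⁻¹ L‖₂`. -/
noncomputable def nuConst {n : ℕ} (G : WeightedDigraph n) (α Δ : ℝ) (w : Fin n → ℝ) : ℝ :=
  α * √((n : ℝ) + 2) * Δ * spectralNorm₂ ((1 - G.qMatrix α w)⁻¹ * G.lap)

/-! Write J = 1ωᵀ, P = I - αL, c = n^(-κ), X(k) = c Z(k) - J, and U(k) for the quantization error at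
time k. Since JL = 0 and L1 = 0, J Z(k) is conserved and X(k+1) = Q X(k) - cα L U(k). Summing over
the averaging window telescopes to (I - Q) ∑ X = Q (X(k₀) - X(k₀+K)) - cα L ∑ U.

Multiply by (I - Q)⁻¹ and measure in L² of the Frobenius norm. The boundary term is bounded
uniformly in K, because the powers of Q have summable norms (`exists_rmsNorm_le_of_recursion`). The
noise term grows only like √K, because each entry of U is uncorrelated over time
(`IsUncorrelatedNoise.rmsNorm_sum_le`). So the root mean square error is at most (D + a√K)/K. Its
square is a²/K + O(K^(-3/2)), and a² ≤ nν²/4.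

Summability rests on a Doeblin argument. P is row stochastic with positive diagonal, so strong
connectivity makes some power entrywise positive. Removing a constant matrix from that power leaves
an ∞-norm contraction, and I - J annihilates the constant part. Both quantization models enter only
through `IsUncorrelatedNoise`. -/

/-! ### Primitive stochastic matrices and decay of powers. -/

theorem Matrix.exists_pow_pos_of_diag_pos {n : ℕ} {M : Matrix (Fin n) (Fin n) ℝ}
    (hM : ∀ i j, 0 ≤ M i j) (hd : ∀ i, 0 < M i i)
    (hc : ∀ i j, Relation.ReflTransGen (fun a b => 0 < M b a) i j) :
    ∃ m, 1 ≤ m ∧ ∀ i j, 0 < (M ^ m) i j := by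
  have hnn : ∀ k i j, 0 ≤ (M ^ k) i j := by
    intro k
    induction k with
    | zero => intro i j; rw [pow_zero, Matrix.one_apply]; split_ifs <;> norm_num
    | succ k ih =>
      intro i j
      rw [pow_succ, Matrix.mul_apply]
      exact Finset.sum_nonneg fun x _ => mul_nonneg (ih i x) (hM x j)
  have hstep : ∀ k i j x, 0 < M x j → 0 < (M ^ k) j i → 0 < (M ^ (k + 1)) x i := by
    intro k i j x h1 h2
    rw [pow_succ', Matrix.mul_apply]
    exact Finset.sum_pos' (fun y _ => mul_nonneg (hM x y) (hnn k y i))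
      ⟨j, Finset.mem_univ _, mul_pos h1 h2⟩
  have hex : ∀ i j, ∃ k, 0 < (M ^ k) j i := by
    intro i j
    induction hc i j with
    | refl => exact ⟨0, by simp⟩
    | tail _ h ih =>
      obtain ⟨k, hk⟩ := ih
      exact ⟨k + 1, hstep k i _ _ h hk⟩
  have hmono : ∀ i j k l, k ≤ l → 0 < (M ^ k) j i → 0 < (M ^ l) j i := by
    intro i j k l hkl hk
    induction l, hkl using Nat.le_induction with
    | base => exact hk
    | succ l _ ih => exact hstep l i j j (hd j) ih
  choose f hf using hex
  -- Positive diagonal entries let positivity persist to larger exponents, so one exponent above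
  -- every `f i j` serves all pairs.
  refine ⟨(∑ i, ∑ j, f i j) + 1, by omega, fun i j => hmono j i _ _ ?_ (hf j i)⟩
  have h1 : f j i ≤ ∑ b, f j b := Finset.single_le_sum (fun _ _ => Nat.zero_le _) (Finset.mem_univ i)
  have h2 : ∑ b, f j b ≤ ∑ a, ∑ b, f a b :=
    Finset.single_le_sum (f := fun a => ∑ b, f a b) (fun _ _ => Nat.zero_le _) (Finset.mem_univ j)
  omega

section
attribute [local instance] Matrix.linftyOpNormedRing

/-- The difference has nonnegative entries, so each absolute row sum equals 1 - nδ. -/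
theorem Matrix.linftyOp_norm_sub_lt_one {n : ℕ} (hn : 0 < n) {B : Matrix (Fin n) (Fin n) ℝ}
    {δ : ℝ} (hδ : 0 < δ) (hB : ∀ i j, δ ≤ B i j) (hrow : ∀ i, ∑ j, B i j = 1) :
    ‖B - Matrix.of fun _ _ => δ‖ < 1 := by
  rw [Matrix.linfty_opNorm_def, ← NNReal.coe_one, NNReal.coe_lt_coe, Finset.sup_lt_iff (by simp)]
  intro i _
  rw [← NNReal.coe_lt_coe]
  push_cast
  have : ∀ j, ‖(B - (Matrix.of fun _ _ => δ : Matrix (Fin n) (Fin n) ℝ)) i j‖ = B i j - δ := by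
    intro j
    rw [Matrix.sub_apply, Matrix.of_apply, Real.norm_of_nonneg (sub_nonneg.2 (hB i j))]
  simp only [this, Finset.sum_sub_distrib, hrow]
  have : (0 : ℝ) < n := by exact_mod_cast hn
  simp only [Finset.sum_const, Finset.card_univ, Fintype.card_fin, nsmul_eq_mul]
  nlinarith [mul_pos this hδ]

/-- I - J is a projection commuting with P and killing constant columns. Hence (P - J)^m = (I - J) C
with C = P^m minus a constant matrix, and powers of this product reduce to (I - J) times powers of
the contraction C. -/
theorem Matrix.exists_tendsto_pow_mul_sub_vecMulVec {n : ℕ} (hn : 0 < n)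
    {P : Matrix (Fin n) (Fin n) ℝ} {w : Fin n → ℝ} {m : ℕ} (hm : 1 ≤ m)
    (hP : ∀ i j, 0 < (P ^ m) i j) (hP1 : P.mulVec (fun _ => 1) = fun _ => 1)
    (hwP : Matrix.vecMul w P = w) (hw1 : ∑ i, w i = 1) :
    Tendsto (fun k : ℕ => (P - Matrix.vecMulVec (fun _ => 1) w) ^ (m * (k + 1))) atTop (nhds 0) := by
  set J := Matrix.vecMulVec (fun _ : Fin n => (1 : ℝ)) w with hJ
  have hPJ : P * J = J := by rw [hJ, Matrix.mul_vecMulVec, hP1]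
  have hJP : J * P = J := by rw [hJ, Matrix.vecMulVec_mul, hwP]
  have hJ1 : J.mulVec (fun _ => 1) = fun _ => 1 := by
    ext i
    simp [hJ, Matrix.mulVec, dotProduct, Matrix.vecMulVec_apply, hw1]
  have hJJ : J * J = J := by
    conv_lhs => rhs; rw [hJ]
    rw [Matrix.mul_vecMulVec, hJ1]
  have hQ : P - J = (1 - J) * P := by rw [sub_mul, one_mul, hJP]
  have hcomm : Commute (1 - J) P := by
    change (1 - J) * P = P * (1 - J)
    rw [sub_mul, mul_sub, one_mul, mul_one, hJP, hPJ]
  have hidem : IsIdempotentElem (1 - J) := by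
    change (1 - J) * (1 - J) = 1 - J
    rw [sub_mul, one_mul, mul_sub, mul_one, hJJ, sub_self, sub_zero]
  obtain ⟨δ, hδ, hδP⟩ : ∃ δ : ℝ, 0 < δ ∧ ∀ i j, δ ≤ (P ^ m) i j := by
    have : Nonempty (Fin n × Fin n) := ⟨(⟨0, hn⟩, ⟨0, hn⟩)⟩
    obtain ⟨x, hx⟩ := Finite.exists_min fun x : Fin n × Fin n => (P ^ m) x.1 x.2
    exact ⟨_, hP x.1 x.2, fun i j => hx (i, j)⟩
  set C := P ^ m - Matrix.of fun _ _ => δ with hC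
  have hrow : ∀ i, ∑ j, (P ^ m) i j = 1 := by
    have : ∀ k, (P ^ k).mulVec (fun _ => 1) = fun _ => 1 := by
      intro k
      induction k with
      | zero => simp
      | succ k ih => rw [pow_succ, ← Matrix.mulVec_mulVec, hP1, ih]
    intro i
    simpa [Matrix.mulVec, dotProduct] using congrFun (this m) i
  have hCn : ‖C‖ < 1 := Matrix.linftyOp_norm_sub_lt_one hn hδ hδP hrow
  have hproj_const : (1 - J) * (Matrix.of fun _ _ => δ : Matrix (Fin n) (Fin n) ℝ) = 0 := by
    ext i j
    rw [sub_mul, one_mul, Matrix.sub_apply, Matrix.mul_apply]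
    simp [hJ, Matrix.vecMulVec_apply, ← Finset.sum_mul, hw1]
  have hQm : (P - J) ^ m = (1 - J) * C := by
    rw [hQ, hcomm.mul_pow, hC, mul_sub, hproj_const, sub_zero]
    obtain ⟨l, rfl⟩ := Nat.exists_eq_add_of_le' hm
    rw [hidem.pow_succ_eq l]
  -- C itself need not commute with 1 - J, but after the left factor 1 - J it may be replaced by P ^
  -- m, which does.
  have hproj_C : (1 - J) * C * (1 - J) = (1 - J) * C := by
    have h : (1 - J) * C = (1 - J) * P ^ m := by rw [hC, mul_sub, hproj_const, sub_zero]
    rw [h, mul_assoc, ← (hcomm.pow_right m).eq, ← mul_assoc, hidem.eq]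
  have hpow : ∀ k, ((1 - J) * C) ^ (k + 1) = (1 - J) * C ^ (k + 1) := by
    intro k
    induction k with
    | zero => simp
    | succ k ih => rw [pow_succ', ih, ← mul_assoc, hproj_C, pow_succ' C (k + 1), mul_assoc]
  simp_rw [pow_mul, hQm, hpow]
  have h0 : Tendsto (fun k => C ^ (k + 1)) atTop (nhds 0) :=
    (tendsto_add_atTop_iff_nat 1).2 (tendsto_pow_atTop_nhds_zero_of_norm_lt_one hCn)
  simpa using h0.const_mul (1 - J)

end

/-! ### Spectral norm, summable powers and invertibility of I - Q. -/

theorem spectralNorm₂_nonneg {n : ℕ} (M : Matrix (Fin n) (Fin n) ℝ) : 0 ≤ spectralNorm₂ M :=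
  norm_nonneg _

theorem spectralNorm₂_mul_le {n : ℕ} (M N : Matrix (Fin n) (Fin n) ℝ) :
    spectralNorm₂ (M * N) ≤ spectralNorm₂ M * spectralNorm₂ N := by
  unfold spectralNorm₂
  rw [map_mul]
  exact norm_mul_le _ _

theorem continuous_spectralNorm₂ {n : ℕ} :
    Continuous (spectralNorm₂ : Matrix (Fin n) (Fin n) ℝ → ℝ) :=
  continuous_norm.comp (LinearMap.continuous_of_finiteDimensional
    (Matrix.toEuclideanCLM (n := Fin n) (𝕜 := ℝ)).toAlgEquiv.toLinearMap)

/-- If some power of `Q` is a contraction, then the partial sums of the norms of the powers of `Q`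
are bounded. -/
theorem exists_sum_spectralNorm₂_pow_le {n : ℕ} {Q : Matrix (Fin n) (Fin n) ℝ} {N : ℕ}
    (hN : spectralNorm₂ (Q ^ N) < 1) :
    ∃ S, ∀ k, ∑ i ∈ Finset.range k, spectralNorm₂ (Q ^ i) ≤ S := by
  set A := ∑ i ∈ Finset.range N, spectralNorm₂ (Q ^ i)
  set ρ := spectralNorm₂ (Q ^ N)
  -- The partial sums T satisfy T(k) ≤ T(N + k) ≤ A + ρ T(k), which is solved for T(k).
  refine ⟨A / (1 - ρ), fun k => ?_⟩
  rw [le_div_iff₀ (by linarith)]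
  have h1 : ∑ i ∈ Finset.range (N + k), spectralNorm₂ (Q ^ i)
      ≤ A + ρ * ∑ i ∈ Finset.range k, spectralNorm₂ (Q ^ i) := by
    rw [Finset.sum_range_add, Finset.mul_sum]
    gcongr with i
    rw [pow_add]
    exact spectralNorm₂_mul_le _ _
  have h2 : ∑ i ∈ Finset.range k, spectralNorm₂ (Q ^ i)
      ≤ ∑ i ∈ Finset.range (N + k), spectralNorm₂ (Q ^ i) :=
    Finset.sum_le_sum_of_subset_of_nonneg (Finset.range_mono (by omega))
      fun _ _ _ => spectralNorm₂_nonneg _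
  linarith

/-- The Neumann series inverts 1 - Q^N, and 1 - Q is a factor of it by the geometric sum identity.
-/
theorem isUnit_one_sub_of_spectralNorm₂_pow_lt_one {n : ℕ} {Q : Matrix (Fin n) (Fin n) ℝ} {N : ℕ}
    (hN : spectralNorm₂ (Q ^ N) < 1) : IsUnit (1 - Q) := by
  have h1 : IsUnit (1 - Q ^ N) := by
    have : IsUnit (Matrix.toEuclideanCLM (n := Fin n) (𝕜 := ℝ) (1 - Q ^ N)) := by
      rw [map_sub, map_one]
      exact isUnit_one_sub_of_norm_lt_one hN
    exact (MulEquiv.isUnit_map (Matrix.toEuclideanCLM (n := Fin n) (𝕜 := ℝ))).1 this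
  rw [← mul_neg_geom_sum, Matrix.isUnit_iff_isUnit_det, Matrix.det_mul] at h1
  exact (Matrix.isUnit_iff_isUnit_det _).2 (isUnit_of_mul_isUnit_left h1)

namespace WeightedDigraph

variable {n : ℕ} (G : WeightedDigraph n)

theorem lap_mulVec_one : G.lap.mulVec (fun _ => 1) = 0 := by
  ext i
  simp [lap, Matrix.mulVec, dotProduct, deg,
    Matrix.diagonal_apply]

theorem exists_spectralNorm₂_qMatrix_pow_lt_one (hG : G.StronglyConnected) {w : Fin n → ℝ}
    (hw : G.IsNormalizedLeftNullVector w) {α : ℝ} (hα : 0 < α) (hαd : ∀ i, α * G.deg i < 1) :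
    ∃ N, spectralNorm₂ (G.qMatrix α w ^ N) < 1 := by
  -- For n = 0 the weights would sum to 0 instead of 1.
  have hn : 0 < n := by
    rcases Nat.eq_zero_or_pos n with rfl | h
    · simpa using hw.2
    · exact h
  have hdiag : ∀ i, (1 - α • G.lap) i i = 1 - α * G.deg i := by
    intro i
    simp [lap, G.no_loops]
  have hoff : ∀ i j, i ≠ j → (1 - α • G.lap) i j = α * G.A i j := by
    intro i j hij
    simp [lap, Matrix.one_apply_ne hij, Matrix.diagonal_apply_ne _ hij]
  have hdpos : ∀ i, 0 < (1 - α • G.lap) i i := fun i => by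
    rw [hdiag]; linarith [hαd i]
  have hnn : ∀ i j, 0 ≤ (1 - α • G.lap) i j := fun i j => by
    rcases eq_or_ne i j with rfl | h
    · exact (hdpos i).le
    · rw [hoff i j h]; exact mul_nonneg hα.le (G.nonneg i j)
  obtain ⟨m, hm, hpos⟩ := Matrix.exists_pow_pos_of_diag_pos hnn hdpos fun i j => by
    refine Relation.ReflTransGen.mono (fun a b hab => ?_) _ _ (hG i j)
    have hne : b ≠ a := by
      rintro rfl
      exact absurd hab (by simp [Edge, G.no_loops])
    rw [hoff b a hne]
    exact mul_pos hα hab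
  have hlim := Matrix.exists_tendsto_pow_mul_sub_vecMulVec (w := w) hn hm hpos
    (by rw [Matrix.sub_mulVec, Matrix.smul_mulVec, G.lap_mulVec_one]; simp)
    (by rw [Matrix.vecMul_sub, Matrix.vecMul_smul, hw.1]; simp) hw.2
  have := (continuous_spectralNorm₂.tendsto 0).comp hlim
  have h0 : spectralNorm₂ (0 : Matrix (Fin n) (Fin n) ℝ) = 0 := by simp [spectralNorm₂]
  rw [h0] at this
  obtain ⟨k, hk⟩ := (this.eventually (gt_mem_nhds one_pos)).exists
  exact ⟨_, hk⟩

end WeightedDigraph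

/-! ### Quantization errors: moments and decorrelation in time. -/

theorem measurable_probQuantize (Δ : ℝ) :
    Measurable fun p : ℝ × ℝ => probQuantize Δ p.1 p.2 := by
  have hf : Measurable fun p : ℝ × ℝ => (⌊p.2 / Δ⌋ : ℝ) :=
    (measurable_of_countable _).comp (Int.measurable_floor.comp (measurable_snd.div_const Δ))
  have hc : Measurable fun p : ℝ × ℝ => (⌈p.2 / Δ⌉ : ℝ) :=
    (measurable_of_countable _).comp (Int.measurable_ceil.comp (measurable_snd.div_const Δ))
  exact Measurable.ite (measurableSet_lt measurable_fst ((measurable_snd.div_const Δ).sub hf))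
    (hc.mul_const Δ) (hf.mul_const Δ)

theorem abs_probQuantize_sub_le {Δ : ℝ} (hΔ : 0 < Δ) (ξ x : ℝ) :
    |probQuantize Δ ξ x - x| ≤ Δ := by
  have hx : x = x / Δ * Δ := by field_simp
  have h : ∀ y : ℝ, |y - x / Δ| ≤ 1 → |y * Δ - x| ≤ Δ := by
    intro y hy
    have : y * Δ - x = (y - x / Δ) * Δ := by rw [sub_mul, ← hx]
    rw [this, abs_mul, abs_of_pos hΔ]
    nlinarith
  unfold probQuantize
  split_ifs
  · refine h _ (abs_le.2 ⟨?_, ?_⟩) <;> linarith [Int.le_ceil (x / Δ), Int.ceil_lt_add_one (x / Δ)]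
  · refine h _ (abs_le.2 ⟨?_, ?_⟩) <;> linarith [Int.floor_le (x / Δ), Int.lt_floor_add_one (x / Δ)]

/-- The quantization error, for a randomization in `[0, 1]`. -/
theorem probQuantize_sub_eq {Δ : ℝ} (hΔ : 0 < Δ) {ξ : ℝ} (hξ : 0 ≤ ξ) (x : ℝ) :
    probQuantize Δ ξ x - x
      = Δ * (Set.Iio (Int.fract (x / Δ))).indicator 1 ξ - Δ * Int.fract (x / Δ) := by
  have hx : x = Δ * (⌊x / Δ⌋ + Int.fract (x / Δ)) := by
    rw [Int.floor_add_fract]; field_simp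
  unfold probQuantize
  rw [Int.self_sub_floor]
  by_cases h : ξ < Int.fract (x / Δ)
  · rw [if_pos h, Set.indicator_of_mem (Set.mem_Iio.2 h), Pi.one_apply,
      Int.ceil_eq_floor_add_one_iff_notMem _ |>.2]
    · push_cast
      linarith
    -- If x / Δ were an integer, its fractional part would be 0, contradicting 0 ≤ ξ < fract.
    · rintro ⟨z, hz⟩
      rw [← hz, Int.fract_intCast] at h
      linarith
  · rw [if_neg h, Set.indicator_of_notMem (by simpa using h)]
    linarith

theorem integral_indicator_Iio_unitInterval {p : ℝ} (hp0 : 0 ≤ p) (hp1 : p ≤ 1) :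
    ∫ ξ in Set.Icc (0 : ℝ) 1, (Set.Iio p).indicator (1 : ℝ → ℝ) ξ = p := by
  rw [integral_indicator_one measurableSet_Iio, Measure.real,
    Measure.restrict_apply measurableSet_Iio]
  have : Set.Iio p ∩ Set.Icc 0 1 = Set.Ico 0 p := by
    ext y
    simp only [Set.mem_inter_iff, Set.mem_Iio, Set.mem_Icc, Set.mem_Ico]
    constructor
    · rintro ⟨h1, h2, -⟩; exact ⟨h2, h1⟩
    · rintro ⟨h1, h2⟩; exact ⟨h2, h1, by linarith⟩
  rw [this, Real.volume_Ico, sub_zero, ENNReal.toReal_ofReal hp0]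

theorem integrable_indicator_Iio_unitInterval (p : ℝ) :
    Integrable ((Set.Iio p).indicator (1 : ℝ → ℝ)) (volume.restrict (Set.Icc (0 : ℝ) 1)) :=
  (integrable_const (1 : ℝ)).indicator measurableSet_Iio

theorem integral_probQuantize_sub {Δ : ℝ} (hΔ : 0 < Δ) (x : ℝ) :
    ∫ ξ in Set.Icc (0 : ℝ) 1, (probQuantize Δ ξ x - x) = 0 := by
  rw [setIntegral_congr_fun measurableSet_Icc fun ξ hξ => probQuantize_sub_eq hΔ hξ.1 x,
    integral_sub ((integrable_indicator_Iio_unitInterval _).const_mul Δ) (integrable_const _),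
    integral_const_mul, integral_indicator_Iio_unitInterval (Int.fract_nonneg _)
      (Int.fract_lt_one _).le]
  simp

/-- The error is Δ times a centred Bernoulli(p) variable, with variance Δ²p(1 - p), maximal at p =
1/2. -/
theorem integral_probQuantize_sub_sq_le {Δ : ℝ} (hΔ : 0 < Δ) (x : ℝ) :
    ∫ ξ in Set.Icc (0 : ℝ) 1, (probQuantize Δ ξ x - x) ^ 2 ≤ Δ ^ 2 / 4 := by
  set p := Int.fract (x / Δ) with hp
  have h : ∀ ξ ∈ Set.Icc (0 : ℝ) 1, (probQuantize Δ ξ x - x) ^ 2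
      = Δ ^ 2 * (1 - 2 * p) * (Set.Iio p).indicator (1 : ℝ → ℝ) ξ + Δ ^ 2 * p ^ 2 := by
    intro ξ hξ
    rw [probQuantize_sub_eq hΔ hξ.1 x, ← hp]
    by_cases hm : ξ ∈ Set.Iio p
    · rw [Set.indicator_of_mem hm, Pi.one_apply]; ring
    · rw [Set.indicator_of_notMem hm]; ring
  rw [setIntegral_congr_fun measurableSet_Icc h,
    integral_add ((integrable_indicator_Iio_unitInterval _).const_mul _) (integrable_const _),
    integral_const_mul, integral_indicator_Iio_unitInterval (Int.fract_nonneg _)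
      (Int.fract_lt_one _).le]
  simp only [integral_const, MeasurableSet.univ, measureReal_restrict_apply, Set.univ_inter,
    Real.volume_real_Icc, sub_zero, smul_eq_mul]
  norm_num
  nlinarith [sq_nonneg (Δ * (2 * p - 1))]

section

variable {Ω : Type*} [MeasurableSpace Ω] {μ : Measure Ω}

/-- The quantization error of independent data is uncorrelated with every bounded function of the
data. -/
theorem integral_mul_probQuantize_sub_eq_zero [IsProbabilityMeasure μ] {Δ : ℝ} (hΔ : 0 < Δ) {ξ X Y : Ω → ℝ} {c : ℝ}
    (hξ : Measurable ξ) (hX : Measurable X) (hY : Measurable Y)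
    (hu : μ.map ξ = volume.restrict (Set.Icc 0 1))
    (hind : IndepFun (fun ω => (X ω, Y ω)) ξ μ) (hb : ∀ ω, |Y ω| ≤ c) :
    ∫ ω, Y ω * (probQuantize Δ (ξ ω) (X ω) - X ω) ∂μ = 0 := by
  have hXY : Measurable fun ω => (X ω, Y ω) := hX.prodMk hY
  have hmap := (indepFun_iff_map_prod_eq_prod_map_map hXY.aemeasurable hξ.aemeasurable).1 hind
  have hg : Measurable fun r : (ℝ × ℝ) × ℝ => r.1.2 * (probQuantize Δ r.2 r.1.1 - r.1.1) :=
    (measurable_snd.comp measurable_fst).mul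
      (((measurable_probQuantize Δ).comp (measurable_snd.prodMk
        (measurable_fst.comp measurable_fst))).sub (measurable_fst.comp measurable_fst))
  have hint : Integrable (fun r : (ℝ × ℝ) × ℝ => r.1.2 * (probQuantize Δ r.2 r.1.1 - r.1.1))
      (μ.map fun ω => ((X ω, Y ω), ξ ω)) := by
    rw [integrable_map_measure hg.aestronglyMeasurable (hXY.prodMk hξ).aemeasurable]
    refine Integrable.of_bound (hg.comp (hXY.prodMk hξ)).aestronglyMeasurable (c * Δ) ?_
    refine Eventually.of_forall fun ω => ?_
    simp only [Function.comp, Real.norm_eq_abs, abs_mul]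
    exact mul_le_mul (hb ω) (abs_probQuantize_sub_le hΔ _ _) (abs_nonneg _)
      ((abs_nonneg _).trans (hb ω))
  have := integral_map (hXY.prodMk hξ).aemeasurable hg.aestronglyMeasurable (μ := μ)
  rw [← this]
  rw [hmap, hu] at hint ⊢
  have : IsProbabilityMeasure (μ.map fun ω => (X ω, Y ω)) :=
    Measure.isProbabilityMeasure_map hXY.aemeasurable
  -- By independence the joint law is a product. The inner integral over ξ vanishes for each fixed
  -- value of the data.
  rw [integral_prod _ hint]
  simp [integral_const_mul, integral_probQuantize_sub hΔ]

theorem integral_probQuantize_sub_sq_le_of_indepFun [IsProbabilityMeasure μ] {Δ : ℝ} (hΔ : 0 < Δ) {ξ X : Ω → ℝ}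
    (hξ : Measurable ξ) (hX : Measurable X)
    (hu : μ.map ξ = volume.restrict (Set.Icc 0 1)) (hind : IndepFun X ξ μ) :
    ∫ ω, (probQuantize Δ (ξ ω) (X ω) - X ω) ^ 2 ∂μ ≤ Δ ^ 2 / 4 := by
  have hmap := (indepFun_iff_map_prod_eq_prod_map_map hX.aemeasurable hξ.aemeasurable).1 hind
  have hg : Measurable fun r : ℝ × ℝ => (probQuantize Δ r.2 r.1 - r.1) ^ 2 :=
    (((measurable_probQuantize Δ).comp measurable_swap).sub measurable_fst).pow_const 2
  have hint : Integrable (fun r : ℝ × ℝ => (probQuantize Δ r.2 r.1 - r.1) ^ 2)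
      (μ.map fun ω => (X ω, ξ ω)) := by
    have := Measure.isProbabilityMeasure_map (μ := μ) (hX.prodMk hξ).aemeasurable
    refine Integrable.of_bound hg.aestronglyMeasurable (Δ ^ 2) (Eventually.of_forall fun r => ?_)
    rw [Real.norm_eq_abs, abs_pow]
    exact pow_le_pow_left₀ (abs_nonneg _) (abs_probQuantize_sub_le hΔ _ _) 2
  have := integral_map (hX.prodMk hξ).aemeasurable hg.aestronglyMeasurable (μ := μ)
  rw [← this]
  rw [hmap, hu] at hint ⊢
  have : IsProbabilityMeasure (μ.map X) := Measure.isProbabilityMeasure_map hX.aemeasurable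
  rw [integral_prod _ hint]
  calc _ ≤ ∫ _, Δ ^ 2 / 4 ∂(μ.map X) :=
        integral_mono hint.integral_prod_left (integrable_const _)
          fun x => integral_probQuantize_sub_sq_le hΔ x
    _ = Δ ^ 2 / 4 := by simp

/-- The quantization errors are square integrable, with second moments at most `Δ ^ 2 / 4`, and
each of their entries is uncorrelated over time. -/
structure IsUncorrelatedNoise {n : ℕ} (μ : Measure Ω) (Δ : ℝ)
    (u : ℕ → Ω → Matrix (Fin n) (Fin n) ℝ) : Prop where
  memLp : ∀ t i l, MemLp (fun ω => u t ω i l) 2 μ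
  sq_le : ∀ t i l, ∫ ω, u t ω i l ^ 2 ∂μ ≤ Δ ^ 2 / 4
  uncorrelated : ∀ s t i l, s < t → ∫ ω, u s ω i l * u t ω i l ∂μ = 0

theorem IndependentQuantizationErrors.isUncorrelatedNoise {n : ℕ} {Δ : ℝ}
    {Z q : ℕ → Ω → Matrix (Fin n) (Fin n) ℝ} (h : IndependentQuantizationErrors μ Δ Z q) :
    IsUncorrelatedNoise μ Δ fun t ω => q t ω - Z t ω := by
  obtain ⟨h1, h2, h3, h4⟩ := h
  refine ⟨h1, h3, fun s t i l hst => ?_⟩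
  have hi := (h4.indepFun (i := (s, i)) (j := (t, i)) (by simp [hst.ne])).comp
    (measurable_pi_apply l) (measurable_pi_apply l)
  have := hi.integral_fun_mul_eq_mul_integral (h1 s i l).aestronglyMeasurable
    (h1 t i l).aestronglyMeasurable
  simp only [Function.comp, h2, mul_zero] at this
  exact this

theorem WeightedDigraph.IsQuantizedIteration.isUncorrelatedNoise [IsProbabilityMeasure μ] {n : ℕ}
    {G : WeightedDigraph n}
    {α κ Δ : ℝ} (hΔ : 0 < Δ) {Z q : ℕ → Ω → Matrix (Fin n) (Fin n) ℝ}
    (hZ : G.IsQuantizedIteration α κ Z q)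
    (hq : IndependentProbabilisticQuantization μ Δ Z q) :
    IsUncorrelatedNoise μ Δ fun t ω => q t ω - Z t ω := by
  obtain ⟨ξ, hξm, hξu, hξi, hξq⟩ := hq
  let M : ℕ × Fin n → MeasurableSpace Ω := fun p =>
    MeasurableSpace.comap (fun ω (l : Fin n) => ξ p.1 p.2 l ω) inferInstance
  have hM : ∀ p, M p ≤ ‹MeasurableSpace Ω› := fun p =>
    (measurable_pi_lambda _ fun l => hξm p.1 p.2 l).comap_le
  -- The past strictly before t: Z t is `F t`-measurable, while q t also uses the randomization at
  -- time t and is only `F (t + 1)`-measurable.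
  let F : ℕ → MeasurableSpace Ω := fun t => ⨆ p ∈ {p : ℕ × Fin n | p.1 < t}, M p
  have hF : ∀ t, F t ≤ ‹MeasurableSpace Ω› := fun t => iSup₂_le fun p _ => hM p
  have hFmono : Monotone F := fun s t hst => biSup_mono fun p (hp : p.1 < s) => hp.trans_le hst
  have hξF : ∀ t i l, Measurable[F (t + 1)] (ξ t i l) := by
    intro t i l
    have h1 : Measurable[M (t, i)] (ξ t i l) :=
      (measurable_pi_apply l).comp (comap_measurable fun ω (l : Fin n) => ξ t i l ω)
    exact h1.mono (le_iSup₂_of_le (t, i) (Nat.lt_succ_self t) le_rfl) le_rfl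
  have hqF : ∀ t, (∀ i l, Measurable[F t] fun ω => Z t ω i l) →
      ∀ i l, Measurable[F (t + 1)] fun ω => q t ω i l := by
    intro t h i l
    simp_rw [hξq t _ i l]
    exact (measurable_probQuantize Δ).comp
      ((hξF t i l).prodMk ((h i l).mono (hFmono (Nat.le_succ t)) le_rfl))
  have hZF : ∀ t i l, Measurable[F t] fun ω => Z t ω i l := by
    intro t
    induction t with
    | zero => intro i l; simp_rw [hZ.init]; exact measurable_const
    | succ t ih =>
      intro i l
      simp_rw [hZ.step]
      refine ((ih i l).mono (hFmono (Nat.le_succ t)) le_rfl).add (Measurable.const_mul ?_ α)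
      exact Finset.measurable_sum _ fun j _ => ((hqF t ih j l).sub (hqF t ih i l)).const_mul _
  have huF : ∀ s t, s < t → ∀ i l, Measurable[F t] fun ω => q s ω i l - Z s ω i l :=
    fun s t hst i l => ((hqF s (hZF s) i l).mono (hFmono hst) le_rfl).sub
      ((hZF s i l).mono (hFmono hst.le) le_rfl)
  have hindep : ∀ t i l, Indep (F t) (MeasurableSpace.comap (ξ t i l) inferInstance) μ := by
    intro t i l
    have h1 : Indep (F t) (⨆ p ∈ ({(t, i)} : Set (ℕ × Fin n)), M p) μ :=
      indep_iSup_of_disjoint hM hξi (by simp)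
    refine indep_of_indep_of_le_right h1 ?_
    simp only [Set.mem_singleton_iff, iSup_iSup_eq_left]
    exact ((measurable_pi_apply l).comp
      (comap_measurable fun ω (l : Fin n) => ξ t i l ω)).comap_le
  have hbdd : ∀ t ω i l, |q t ω i l - Z t ω i l| ≤ Δ := fun t ω i l => by
    rw [hξq]; exact abs_probQuantize_sub_le hΔ _ _
  refine ⟨fun t i l => ?_, fun t i l => ?_, fun s t i l hst => ?_⟩
  · exact MemLp.of_bound ((huF t (t + 1) t.lt_succ_self i l).mono (hF _) le_rfl).aestronglyMeasurable
      Δ (Eventually.of_forall fun ω => hbdd t ω i l)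
  · simp only [Matrix.sub_apply, hξq]
    exact integral_probQuantize_sub_sq_le_of_indepFun hΔ (hξm t i l)
      ((hZF t i l).mono (hF t) le_rfl) (hξu t i l)
      ((IndepFun_iff_Indep _ _ _).2 (indep_of_indep_of_le_left (hindep t i l) (hZF t i l).comap_le))
  · simp only [Matrix.sub_apply]
    -- Only the later error is unfolded; the error at time s plays the bounded data `Y`.
    simp only [hξq t]
    exact integral_mul_probQuantize_sub_eq_zero hΔ (hξm t i l)
      ((hZF t i l).mono (hF t) le_rfl) ((huF s t hst i l).mono (hF t) le_rfl) (hξu t i l)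
      ((IndepFun_iff_Indep _ _ _).2 (indep_of_indep_of_le_left (hindep t i l)
        ((hZF t i l).prodMk (huF s t hst i l)).comap_le)) fun ω => hbdd s ω i l

/-- Second moment of a sum of uncorrelated random variables. -/
theorem integral_sum_sq_le_of_uncorrelated {c : ℝ} {f : ℕ → Ω → ℝ} (hf : ∀ k, MemLp (f k) 2 μ)
    (hc : ∀ k, ∫ ω, f k ω ^ 2 ∂μ ≤ c) (h0 : ∀ s t, s < t → ∫ ω, f s ω * f t ω ∂μ = 0) (K : ℕ) :
    ∫ ω, (∑ k ∈ Finset.range K, f k ω) ^ 2 ∂μ ≤ K * c := by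
  induction K with
  | zero => simp
  | succ K ih =>
    have hS : MemLp (fun ω => ∑ k ∈ Finset.range K, f k ω) 2 μ :=
      memLp_finsetSum _ fun k _ => hf k
    have hcross : ∫ ω, (∑ k ∈ Finset.range K, f k ω) * f K ω ∂μ = 0 := by
      simp_rw [Finset.sum_mul]
      have h : ∀ k ∈ Finset.range K, Integrable (fun ω => f k ω * f K ω) μ :=
        fun k _ => (hf k).integrable_mul (hf K)
      rw [integral_finsetSum _ h]
      exact Finset.sum_eq_zero fun k hk => h0 k K (Finset.mem_range.1 hk)
    simp_rw [Finset.sum_range_succ, add_sq, mul_assoc (2 : ℝ)]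
    have h1 := hS.integrable_sq
    have h2 : Integrable (fun ω => 2 * ((∑ k ∈ Finset.range K, f k ω) * f K ω)) μ :=
      (hS.integrable_mul (hf K)).const_mul 2
    rw [integral_add (f := fun ω => _ + _) (h1.add h2) (hf K).integrable_sq, integral_add h1 h2,
      integral_const_mul, hcross]
    push_cast
    linarith [hc K]

end

/-! ### Frobenius norm and mean square estimates. -/

theorem frobeniusNorm_sq {n : ℕ} (M : Matrix (Fin n) (Fin n) ℝ) :
    frobeniusNorm M ^ 2 = ∑ i, ∑ l, M i l ^ 2 := by
  unfold frobeniusNorm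
  rw [Matrix.frobenius_norm_def, ← Real.sqrt_eq_rpow, Real.sq_sqrt (by positivity)]
  simp

theorem frobeniusNorm_nonneg {n : ℕ} (M : Matrix (Fin n) (Fin n) ℝ) : 0 ≤ frobeniusNorm M :=
  letI := Matrix.frobeniusNormedAddCommGroup (m := Fin n) (n := Fin n) (α := ℝ)
  norm_nonneg M

theorem frobeniusNorm_add_le {n : ℕ} (M N : Matrix (Fin n) (Fin n) ℝ) :
    frobeniusNorm (M + N) ≤ frobeniusNorm M + frobeniusNorm N :=
  letI := Matrix.frobeniusNormedAddCommGroup (m := Fin n) (n := Fin n) (α := ℝ)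
  norm_add_le M N

theorem frobeniusNorm_smul {n : ℕ} (c : ℝ) (M : Matrix (Fin n) (Fin n) ℝ) :
    frobeniusNorm (c • M) = |c| * frobeniusNorm M :=
  letI := Matrix.frobeniusNormedAddCommGroup (m := Fin n) (n := Fin n) (α := ℝ)
  letI := Matrix.frobeniusNormedSpace (m := Fin n) (n := Fin n) (R := ℝ) (α := ℝ)
  norm_smul c M

/-- The operator norm bound is applied to each column of N, and the squares are added. -/
theorem frobeniusNorm_mul_le {n : ℕ} (M N : Matrix (Fin n) (Fin n) ℝ) :
    frobeniusNorm (M * N) ≤ spectralNorm₂ M * frobeniusNorm N := by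
  refine le_of_abs_le (abs_le_of_sq_le_sq ?_ (mul_nonneg (spectralNorm₂_nonneg M) (frobeniusNorm_nonneg N)))
  rw [mul_pow, frobeniusNorm_sq, frobeniusNorm_sq, Finset.sum_comm,
    Finset.sum_comm (f := fun i l => N i l ^ 2), Finset.mul_sum]
  refine Finset.sum_le_sum fun l _ => ?_
  have h := (Matrix.toEuclideanCLM (n := Fin n) (𝕜 := ℝ) M).le_opNorm
    (WithLp.toLp 2 fun i => N i l)
  have h2 := pow_le_pow_left₀ (norm_nonneg _) h 2
  rw [mul_pow, EuclideanSpace.real_norm_sq_eq, EuclideanSpace.real_norm_sq_eq] at h2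
  exact h2

section

variable {Ω : Type*} [MeasurableSpace Ω] {μ : Measure Ω} {n : ℕ}

/-- All entries of the random matrix are square integrable. -/
def EntriesMemLp (μ : Measure Ω) (F : Ω → Matrix (Fin n) (Fin n) ℝ) : Prop :=
  ∀ i l, MemLp (fun ω => F ω i l) 2 μ

/-- The root mean square of the Frobenius norm of a random matrix. -/
noncomputable def rmsNorm (μ : Measure Ω) (F : Ω → Matrix (Fin n) (Fin n) ℝ) : ℝ :=
  lpNorm (fun ω => frobeniusNorm (F ω)) 2 μ

namespace EntriesMemLp

variable {F H : Ω → Matrix (Fin n) (Fin n) ℝ}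

theorem add (hF : EntriesMemLp μ F) (hH : EntriesMemLp μ H) :
    EntriesMemLp μ fun ω => F ω + H ω := fun i l => (hF i l).add (hH i l)

theorem sub (hF : EntriesMemLp μ F) (hH : EntriesMemLp μ H) :
    EntriesMemLp μ fun ω => F ω - H ω := fun i l => (hF i l).sub (hH i l)

theorem smul (c : ℝ) (hF : EntriesMemLp μ F) :
    EntriesMemLp μ fun ω => c • F ω := fun i l => (hF i l).const_mul c

theorem const_mul (M : Matrix (Fin n) (Fin n) ℝ) (hF : EntriesMemLp μ F) :
    EntriesMemLp μ fun ω => M * F ω := fun i l => by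
  simp_rw [Matrix.mul_apply]
  exact memLp_finsetSum _ fun j _ => (hF j l).const_mul _

theorem sum {ι : Type*} (s : Finset ι) {F : ι → Ω → Matrix (Fin n) (Fin n) ℝ}
    (hF : ∀ k ∈ s, EntriesMemLp μ (F k)) : EntriesMemLp μ fun ω => ∑ k ∈ s, F k ω := fun i l => by
  simp_rw [Matrix.sum_apply]
  exact memLp_finsetSum _ fun k hk => hF k hk i l

theorem integrable_sq (hF : EntriesMemLp μ F) :
    Integrable (fun ω => frobeniusNorm (F ω) ^ 2) μ := by
  simp_rw [frobeniusNorm_sq]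
  exact integrable_finsetSum _ fun i _ => integrable_finsetSum _ fun l _ => (hF i l).integrable_sq

theorem memLp (hF : EntriesMemLp μ F) : MemLp (fun ω => frobeniusNorm (F ω)) 2 μ := by
  refine (memLp_two_iff_integrable_sq ?_).2 hF.integrable_sq
  have h := Real.continuous_sqrt.comp_aestronglyMeasurable hF.integrable_sq.aestronglyMeasurable
  simpa only [Real.sqrt_sq (frobeniusNorm_nonneg _)] using h

theorem rmsNorm_sq (hF : EntriesMemLp μ F) :
    rmsNorm μ F ^ 2 = ∫ ω, frobeniusNorm (F ω) ^ 2 ∂μ := by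
  have h : 0 ≤ ∫ ω, frobeniusNorm (F ω) ^ 2 ∂μ := integral_nonneg fun _ => sq_nonneg _
  rw [rmsNorm, lpNorm_eq_integral_norm_rpow_toReal two_ne_zero ENNReal.ofNat_ne_top
    hF.memLp.aestronglyMeasurable]
  simp only [ENNReal.toReal_ofNat, Real.rpow_ofNat, Real.norm_eq_abs, sq_abs]
  rw [← Real.rpow_ofNat, ← Real.rpow_mul h]
  norm_num

end EntriesMemLp

theorem entriesMemLp_const [IsFiniteMeasure μ] (M : Matrix (Fin n) (Fin n) ℝ) :
    EntriesMemLp μ fun _ => M := fun _ _ => memLp_const _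

variable {F H : Ω → Matrix (Fin n) (Fin n) ℝ}

theorem rmsNorm_nonneg : 0 ≤ rmsNorm μ F := lpNorm_nonneg

theorem rmsNorm_add_le (hF : EntriesMemLp μ F) (hH : EntriesMemLp μ H) :
    rmsNorm μ (fun ω => F ω + H ω) ≤ rmsNorm μ F + rmsNorm μ H := by
  refine (lpNorm_mono_real (hF.memLp.add hH.memLp) fun ω => ?_).trans
    (lpNorm_add_le hF.memLp one_le_two)
  rw [Real.norm_of_nonneg (frobeniusNorm_nonneg _)]
  exact frobeniusNorm_add_le _ _

theorem rmsNorm_smul (c : ℝ) :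
    rmsNorm μ (fun ω => c • F ω) = |c| * rmsNorm μ F := by
  unfold rmsNorm
  simp_rw [frobeniusNorm_smul]
  rw [show (fun ω => |c| * frobeniusNorm (F ω)) = |c| • fun ω => frobeniusNorm (F ω) from rfl,
    lpNorm_const_smul]
  simp

theorem rmsNorm_sub_le (hF : EntriesMemLp μ F) (hH : EntriesMemLp μ H) :
    rmsNorm μ (fun ω => F ω - H ω) ≤ rmsNorm μ F + rmsNorm μ H := by
  have h := rmsNorm_add_le hF (hH.smul (-1))
  rw [rmsNorm_smul] at h
  simpa [sub_eq_add_neg] using h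

theorem rmsNorm_const_mul_le (M : Matrix (Fin n) (Fin n) ℝ) (hF : EntriesMemLp μ F) :
    rmsNorm μ (fun ω => M * F ω) ≤ spectralNorm₂ M * rmsNorm μ F := by
  have h := rmsNorm_smul (μ := μ) (F := F) (spectralNorm₂ M)
  rw [abs_of_nonneg (spectralNorm₂_nonneg M)] at h
  rw [← h]
  refine lpNorm_mono_real (hF.smul _).memLp fun ω => ?_
  rw [Real.norm_of_nonneg (frobeniusNorm_nonneg _), frobeniusNorm_smul,
    abs_of_nonneg (spectralNorm₂_nonneg M)]
  exact frobeniusNorm_mul_le _ _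

/-- The squared Frobenius norm splits over n² entries, each contributing at most KΔ²/4; correlations
between different entries never enter. -/
theorem IsUncorrelatedNoise.rmsNorm_sum_le {Δ : ℝ} (hΔ : 0 < Δ)
    {u : ℕ → Ω → Matrix (Fin n) (Fin n) ℝ} (hu : IsUncorrelatedNoise μ Δ u) (k₀ K : ℕ) :
    rmsNorm μ (fun ω => ∑ k ∈ Finset.range K, u (k₀ + k) ω) ≤ n * Δ / 2 * √K := by
  have hmem : EntriesMemLp μ fun ω => ∑ k ∈ Finset.range K, u (k₀ + k) ω :=
    EntriesMemLp.sum _ fun k _ => hu.memLp (k₀ + k)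
  refine le_of_abs_le (abs_le_of_sq_le_sq ?_ (by positivity))
  rw [hmem.rmsNorm_sq]
  simp_rw [frobeniusNorm_sq]
  rw [integral_finsetSum _ fun i _ => integrable_finsetSum _ fun l _ => (hmem i l).integrable_sq]
  calc _ ≤ ∑ i : Fin n, ∑ l : Fin n, K * (Δ ^ 2 / 4) := by
        refine Finset.sum_le_sum fun i _ => ?_
        rw [integral_finsetSum _ fun l _ => (hmem i l).integrable_sq]
        refine Finset.sum_le_sum fun l _ => ?_
        simp_rw [Matrix.sum_apply]
        exact integral_sum_sq_le_of_uncorrelated (fun k => hu.memLp (k₀ + k) i l)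
          (fun k => hu.sq_le (k₀ + k) i l) (fun s t h => hu.uncorrelated _ _ i l (by omega)) K
    _ = (n * Δ / 2 * √K) ^ 2 := by
        rw [mul_pow, Real.sq_sqrt (Nat.cast_nonneg K)]
        simp
        ring

/-- A random recursion `X (k + 1) = Q X k + V k` is bounded in mean square if the noise is, and
if the norms of the powers of `Q` are summable. -/
theorem exists_rmsNorm_le_of_recursion {Q : Matrix (Fin n) (Fin n) ℝ} {S c : ℝ} (hc : 0 ≤ c)
    (hS : ∀ k, ∑ i ∈ Finset.range k, spectralNorm₂ (Q ^ i) ≤ S)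
    {X V : ℕ → Ω → Matrix (Fin n) (Fin n) ℝ} (hX : ∀ k, EntriesMemLp μ (X k))
    (hV : ∀ k, EntriesMemLp μ (V k)) (hVc : ∀ k, rmsNorm μ (V k) ≤ c)
    (hstep : ∀ k ω, X (k + 1) ω = Q * X k ω + V k ω) :
    ∃ B, ∀ k, rmsNorm μ (X k) ≤ B := by
  -- The extra factor Q ^ j makes the induction close: one step of the recursion trades (k + 1, j)
  -- for (k, j + 1).
  have key : ∀ k j, rmsNorm μ (fun ω => Q ^ j * X k ω) ≤ spectralNorm₂ (Q ^ (j + k)) *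
      rmsNorm μ (X 0) + c * ∑ i ∈ Finset.range k, spectralNorm₂ (Q ^ (j + i)) := by
    intro k
    induction k with
    | zero => intro j; simpa using rmsNorm_const_mul_le (Q ^ j) (hX 0)
    | succ k ih =>
      intro j
      have h1 : ∀ ω, Q ^ j * X (k + 1) ω = Q ^ (j + 1) * X k ω + Q ^ j * V k ω := fun ω => by
        rw [hstep, mul_add, ← mul_assoc, pow_succ]
      simp_rw [h1]
      refine (rmsNorm_add_le ((hX k).const_mul _) ((hV k).const_mul _)).trans ?_
      have h2 := ih (j + 1)
      have h3 : rmsNorm μ (fun ω => Q ^ j * V k ω) ≤ c * spectralNorm₂ (Q ^ j) :=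
        (rmsNorm_const_mul_le (Q ^ j) (hV k)).trans (by
          rw [mul_comm c]
          exact mul_le_mul_of_nonneg_left (hVc k) (spectralNorm₂_nonneg _))
      rw [Finset.sum_range_succ', mul_add, add_zero]
      simp only [add_assoc, add_comm 1] at h2 ⊢
      linarith
  refine ⟨S * rmsNorm μ (X 0) + c * S, fun k => ?_⟩
  have h := key k 0
  simp only [pow_zero, one_mul, zero_add] at h
  have h1 : spectralNorm₂ (Q ^ k) ≤ S := by
    refine le_trans ?_ (hS (k + 1))
    rw [Finset.sum_range_succ]
    exact le_add_of_nonneg_left (Finset.sum_nonneg fun _ _ => spectralNorm₂_nonneg _)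
  have h2 := mul_le_mul_of_nonneg_right h1 (rmsNorm_nonneg (μ := μ) (F := X 0))
  have h3 := mul_le_mul_of_nonneg_left (hS k) hc
  linarith

end

/-! ### The quantized iteration and its deviation from 1ωᵀ. -/

namespace WeightedDigraph

variable {n : ℕ} {G : WeightedDigraph n} {w : Fin n → ℝ} {α κ : ℝ} {Ω : Type*}
  {Z q : ℕ → Ω → Matrix (Fin n) (Fin n) ℝ}

theorem IsQuantizedIteration.step_matrix (hZ : G.IsQuantizedIteration α κ Z q) (t : ℕ) (ω : Ω) :
    Z (t + 1) ω = Z t ω - α • (G.lap * q t ω) := by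
  ext i l
  rw [hZ.step, Matrix.sub_apply, Matrix.smul_apply, lap, Matrix.sub_mul, Matrix.sub_apply,
    Matrix.diagonal_mul, Matrix.mul_apply, deg, Finset.sum_mul, smul_eq_mul]
  simp_rw [mul_sub, Finset.sum_sub_distrib]
  ring

theorem vecMulVec_mul_lap (hw : G.IsNormalizedLeftNullVector w) :
    Matrix.vecMulVec (fun _ : Fin n => 1) w * G.lap = 0 := by
  rw [Matrix.vecMulVec_mul, hw.1]
  ext i j
  simp [Matrix.vecMulVec_apply]

/-- Conservation law: each update adds a multiple of L, which J annihilates from the left, whatever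
the quantization errors are. -/
theorem IsQuantizedIteration.vecMulVec_mul (hw : G.IsNormalizedLeftNullVector w)
    (hZ : G.IsQuantizedIteration α κ Z q) (t : ℕ) (ω : Ω) :
    Matrix.vecMulVec (fun _ : Fin n => 1) w * Z t ω
      = ((n : ℝ) ^ κ) • Matrix.vecMulVec (fun _ : Fin n => 1) w := by
  induction t with
  | zero => rw [hZ.init, mul_smul_comm, mul_one]
  | succ t ih =>
    rw [hZ.step_matrix, mul_sub, ih, mul_smul_comm, ← mul_assoc, vecMulVec_mul_lap hw, zero_mul,
      smul_zero, sub_zero]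

/-- The rescaled deviation of the state from `1 wᵀ`. -/
noncomputable def deviation (κ : ℝ) (w : Fin n → ℝ) (Z : ℕ → Ω → Matrix (Fin n) (Fin n) ℝ)
    (k : ℕ) (ω : Ω) : Matrix (Fin n) (Fin n) ℝ :=
  ((n : ℝ) ^ κ)⁻¹ • Z k ω - Matrix.vecMulVec (fun _ : Fin n => 1) w

/-- The conservation law gives J X = 0, so I - αL may be replaced by Q when it acts on the
deviation. -/
theorem IsQuantizedIteration.deviation_succ (hn : 0 < n) (hw : G.IsNormalizedLeftNullVector w)
    (hZ : G.IsQuantizedIteration α κ Z q) (k : ℕ) (ω : Ω) :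
    deviation κ w Z (k + 1) ω = G.qMatrix α w * deviation κ w Z k ω
      - (((n : ℝ) ^ κ)⁻¹ * α) • (G.lap * (q k ω - Z k ω)) := by
  have hc : (n : ℝ) ^ κ ≠ 0 := (Real.rpow_pos_of_pos (by exact_mod_cast hn) κ).ne'
  have h1 := hZ.vecMulVec_mul hw k ω
  have h2 := vecMulVec_mul_lap hw
  have hJ1 : (Matrix.vecMulVec (fun _ : Fin n => (1 : ℝ)) w).mulVec (fun _ => 1) = fun _ => 1 := by
    ext i
    simp [Matrix.mulVec, dotProduct, Matrix.vecMulVec_apply, hw.2]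
  have hLJ : G.lap * Matrix.vecMulVec (fun _ : Fin n => 1) w = 0 := by
    rw [Matrix.mul_vecMulVec, G.lap_mulVec_one, Matrix.zero_vecMulVec]
  have hJJ : Matrix.vecMulVec (fun _ : Fin n => 1) w * Matrix.vecMulVec (fun _ : Fin n => 1) w
      = Matrix.vecMulVec (fun _ : Fin n => (1 : ℝ)) w := by
    rw [Matrix.mul_vecMulVec, hJ1]
  unfold deviation qMatrix
  rw [hZ.step_matrix]
  simp only [sub_mul, mul_sub, one_mul, smul_mul_assoc, mul_smul_comm, h1, hLJ, hJJ, smul_sub,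
    smul_smul, inv_mul_cancel₀ hc, one_smul, smul_zero]
  abel

/-- One step reads (I - Q) X(k+1) = Q (X(k) - X(k+1)) minus noise, and the differences telescope. -/
theorem IsQuantizedIteration.one_sub_mul_sum_deviation (hn : 0 < n)
    (hw : G.IsNormalizedLeftNullVector w) (hZ : G.IsQuantizedIteration α κ Z q) (k₀ K : ℕ) (ω : Ω) :
    (1 - G.qMatrix α w) * ∑ k ∈ Finset.range K, deviation κ w Z (k₀ + k + 1) ω
      = G.qMatrix α w * (deviation κ w Z k₀ ω - deviation κ w Z (k₀ + K) ω)
        - (((n : ℝ) ^ κ)⁻¹ * α) • (G.lap * ∑ k ∈ Finset.range K, (q (k₀ + k) ω - Z (k₀ + k) ω)) := by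
  induction K with
  | zero => simp
  | succ K ih =>
    have h := hZ.deviation_succ hn hw (k₀ + K) ω
    have h' : (1 - G.qMatrix α w) * deviation κ w Z (k₀ + K + 1) ω
        = G.qMatrix α w * deviation κ w Z (k₀ + K) ω
          - (((n : ℝ) ^ κ)⁻¹ * α) • (G.lap * (q (k₀ + K) ω - Z (k₀ + K) ω))
          - G.qMatrix α w * deviation κ w Z (k₀ + K + 1) ω := by
      rw [sub_mul, one_mul, ← h]
    rw [Finset.sum_range_succ, mul_add, ih, h', Finset.sum_range_succ, mul_add G.lap, smul_add,
      ← add_assoc k₀ K 1, mul_sub (G.qMatrix α w), mul_sub (G.qMatrix α w)]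
    abel

theorem IsQuantizedIteration.entriesMemLp [MeasurableSpace Ω] {μ : Measure Ω} [IsFiniteMeasure μ]
    (hZ : G.IsQuantizedIteration α κ Z q)
    (hu : ∀ t, EntriesMemLp μ fun ω => q t ω - Z t ω) (t : ℕ) : EntriesMemLp μ (Z t) := by
  induction t with
  | zero => rw [show Z 0 = fun _ => _ from funext hZ.init]; exact entriesMemLp_const _
  | succ t ih =>
    have h : EntriesMemLp μ (q t) := by simpa using (hu t).add ih
    rw [show Z (t + 1) = fun ω => _ from funext (hZ.step_matrix t)]
    exact ih.sub ((h.const_mul _).smul _)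

/-- K ≥ 1 matters: at K = 0 the average is 0, so the left side is -J while the right side is 0. -/
theorem runningAverage_sub_vecMulVec {k₀ K : ℕ} (hK : 1 ≤ K) (ω : Ω) :
    runningAverage κ k₀ Z K ω - Matrix.vecMulVec (fun _ : Fin n => 1) w
      = (K : ℝ)⁻¹ • ∑ k ∈ Finset.range K, deviation κ w Z (k₀ + k + 1) ω := by
  have hK0 : (K : ℝ) ≠ 0 := by positivity
  have h : ∑ k ∈ Finset.Icc (k₀ + 1) (k₀ + K), Z k ω
      = ∑ k ∈ Finset.range K, Z (k₀ + k + 1) ω := by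
    rw [← Finset.Ico_add_one_right_eq_Icc, Finset.sum_Ico_eq_sum_range]
    refine Finset.sum_congr (by congr 1; omega) fun k _ => ?_
    rw [add_right_comm]
  unfold runningAverage deviation
  rw [h, Finset.sum_sub_distrib, Finset.sum_const, Finset.card_range, smul_sub, ← Finset.smul_sum,
    smul_comm, ← Nat.cast_smul_eq_nsmul ℝ, inv_smul_smul₀ hK0]

/-- The root mean square error of the running average is at most `(D + a √K) / K`, with an explicit
leading constant `a`. -/
theorem IsQuantizedIteration.exists_rmsNorm_runningAverage_le [MeasurableSpace Ω] {μ : Measure Ω}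
    [IsProbabilityMeasure μ] (hG : G.StronglyConnected) (hw : G.IsNormalizedLeftNullVector w)
    (hα : 0 < α) (hαd : ∀ i, α * G.deg i < 1) {Δ : ℝ} (hΔ : 0 < Δ) (hκ : 0 ≤ κ)
    (hZ : G.IsQuantizedIteration α κ Z q)
    (hu : IsUncorrelatedNoise μ Δ fun t ω => q t ω - Z t ω) (k₀ : ℕ) :
    ∃ D, ∀ K : ℕ, 1 ≤ K →
      rmsNorm μ (fun ω => runningAverage κ k₀ Z K ω - Matrix.vecMulVec (fun _ : Fin n => 1) w)
        ≤ (K : ℝ)⁻¹ * (D + α * spectralNorm₂ ((1 - G.qMatrix α w)⁻¹ * G.lap) * (n * Δ / 2) * √K) := by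
  have hn : 0 < n := by
    rcases Nat.eq_zero_or_pos n with rfl | h
    · simpa using hw.2
    · exact h
  have hn1 : (1 : ℝ) ≤ n := by exact_mod_cast hn
  set c := ((n : ℝ) ^ κ)⁻¹ with hc
  have hc0 : 0 ≤ c := by positivity
  -- This lets the final noise bound drop c, so the leading constant is free of κ.
  have hc1 : c ≤ 1 := inv_le_one_of_one_le₀ (Real.one_le_rpow hn1 hκ)
  obtain ⟨N, hN⟩ := G.exists_spectralNorm₂_qMatrix_pow_lt_one hG hw hα hαd
  obtain ⟨S, hS⟩ := exists_sum_spectralNorm₂_pow_le hN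
  have hunit := isUnit_one_sub_of_spectralNorm₂_pow_lt_one hN
  set Q := G.qMatrix α w with hQ
  have hZm := hZ.entriesMemLp hu.memLp
  have hXm : ∀ k, EntriesMemLp μ (deviation κ w Z k) := fun k =>
    ((hZm k).smul _).sub (entriesMemLp_const _)
  have hU : ∀ k, rmsNorm μ (fun ω => q k ω - Z k ω) ≤ n * Δ / 2 := fun k => by
    simpa using hu.rmsNorm_sum_le hΔ k 1
  obtain ⟨B, hB⟩ := exists_rmsNorm_le_of_recursion (μ := μ) (X := deviation κ w Z)
    (V := fun k ω => (-(c * α)) • (G.lap * (q k ω - Z k ω)))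
    (c := |-(c * α)| * (spectralNorm₂ G.lap * (n * Δ / 2)))
    (mul_nonneg (abs_nonneg _) (mul_nonneg (spectralNorm₂_nonneg _) (by positivity)))
    hS hXm (fun k => (EntriesMemLp.const_mul G.lap (hu.memLp k)).smul _)
    (fun k => by
      rw [rmsNorm_smul]
      refine mul_le_mul_of_nonneg_left ?_ (abs_nonneg _)
      exact (rmsNorm_const_mul_le _ (hu.memLp k)).trans
        (mul_le_mul_of_nonneg_left (hU k) (spectralNorm₂_nonneg _)))
    (fun k ω => by rw [hZ.deviation_succ hn hw, neg_smul, sub_eq_add_neg])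
  set R := (1 - Q)⁻¹ with hR
  -- The two copies of B bound the deviations at the two ends of the telescoped sum.
  refine ⟨spectralNorm₂ (R * Q) * (B + B), fun K hK => ?_⟩
  have hsum : ∀ ω, ∑ k ∈ Finset.range K, deviation κ w Z (k₀ + k + 1) ω
      = R * Q * (deviation κ w Z k₀ ω - deviation κ w Z (k₀ + K) ω)
        - (c * α) • (R * G.lap * ∑ k ∈ Finset.range K, (q (k₀ + k) ω - Z (k₀ + k) ω)) := by
    intro ω
    have h := congrArg (R * ·) (hZ.one_sub_mul_sum_deviation hn hw k₀ K ω)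
    simp only [← hQ] at h
    rw [← mul_assoc, hR, Matrix.nonsing_inv_mul _ ((Matrix.isUnit_iff_isUnit_det _).1 hunit),
      one_mul, mul_sub, mul_smul_comm, ← mul_assoc, ← mul_assoc] at h
    exact h
  simp_rw [runningAverage_sub_vecMulVec hK]
  rw [rmsNorm_smul, abs_of_nonneg (by positivity)]
  refine mul_le_mul_of_nonneg_left ?_ (by positivity)
  simp_rw [hsum]
  have hsm : EntriesMemLp μ fun ω => ∑ k ∈ Finset.range K, (q (k₀ + k) ω - Z (k₀ + k) ω) :=
    EntriesMemLp.sum _ fun k _ => hu.memLp (k₀ + k)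
  have hdm := (hXm k₀).sub (hXm (k₀ + K))
  refine (rmsNorm_sub_le (hdm.const_mul _) ((hsm.const_mul _).smul _)).trans (add_le_add ?_ ?_)
  · refine (rmsNorm_const_mul_le _ hdm).trans
      (mul_le_mul_of_nonneg_left ?_ (spectralNorm₂_nonneg _))
    exact (rmsNorm_sub_le (hXm _) (hXm _)).trans (add_le_add (hB _) (hB _))
  · rw [rmsNorm_smul, abs_of_nonneg (mul_nonneg hc0 hα.le)]
    have h1 : rmsNorm μ (fun ω => R * G.lap * ∑ k ∈ Finset.range K, (q (k₀ + k) ω - Z (k₀ + k) ω))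
        ≤ spectralNorm₂ (R * G.lap) * (n * Δ / 2 * √K) :=
      (rmsNorm_const_mul_le _ hsm).trans
        (mul_le_mul_of_nonneg_left (hu.rmsNorm_sum_le hΔ k₀ K) (spectralNorm₂_nonneg _))
    calc c * α * _ ≤ α * (spectralNorm₂ (R * G.lap) * (n * Δ / 2 * √K)) :=
          mul_le_mul (mul_le_of_le_one_left hα.le hc1) h1 rmsNorm_nonneg hα.le
      _ = _ := by ring

end WeightedDigraph

/-! ### The remainder and the final rate. -/

theorem isLittleO_add_mul_sqrt_div_sq (a b : ℝ) :
    (fun K : ℕ => (a + b * √K) / (K : ℝ) ^ 2) =o[atTop] fun K : ℕ => 1 / (K : ℝ) := by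
  have hK : Tendsto (fun K : ℕ => (K : ℝ)) atTop atTop := tendsto_natCast_atTop_atTop
  rw [isLittleO_iff_tendsto' ((eventually_ge_atTop 1).mono fun K hK h => by
    have : (0 : ℝ) < K := by exact_mod_cast hK
    simp [this.ne'] at h)]
  have h : Tendsto (fun K : ℕ => a * (K : ℝ)⁻¹ + b * (√(K : ℝ))⁻¹) atTop (nhds (a * 0 + b * 0)) :=
    ((tendsto_inv_atTop_zero.comp hK).const_mul a).add
      ((tendsto_inv_atTop_zero.comp (Real.tendsto_sqrt_atTop.comp hK)).const_mul b)
  simp only [mul_zero, add_zero] at h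
  refine h.congr' ((eventually_ge_atTop 1).mono fun K hK => ?_)
  have hK0 : (0 : ℝ) < K := by exact_mod_cast hK
  have hs : 0 < √(K : ℝ) := Real.sqrt_pos.2 hK0
  have hsq : √(K : ℝ) ^ 2 = K := Real.sq_sqrt hK0.le
  field_simp
  linear_combination (-b) * hsq

theorem theorem1 {n : ℕ} (G : WeightedDigraph n) (hG : G.StronglyConnected)
    (w : Fin n → ℝ) (hw : G.IsNormalizedLeftNullVector w)
    (α : ℝ) (hα : 0 < α) (hαd : ∀ i, α * G.deg i < 1)
    (Δ : ℝ) (hΔ : 0 < Δ) (κ : ℝ) (hκ : 0 ≤ κ) (k₀ : ℕ)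
    {Ω : Type*} [MeasurableSpace Ω] (μ : Measure Ω) [IsProbabilityMeasure μ]
    (Z q : ℕ → Ω → Matrix (Fin n) (Fin n) ℝ)
    (hZ : G.IsQuantizedIteration α κ Z q)
    (hq : IndependentProbabilisticQuantization μ Δ Z q ∨ IndependentQuantizationErrors μ Δ Z q) :
    IsUnit (1 - G.qMatrix α w) ∧
    (∀ K, Integrable (sqError κ k₀ w Z K) μ) ∧
    Tendsto (fun K => ∫ ω, sqError κ k₀ w Z K ω ∂μ) atTop (nhds 0) ∧
    ∃ r : ℕ → ℝ, r =o[atTop] (fun K : ℕ => 1 / (K : ℝ)) ∧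
      ∀ K : ℕ, 1 ≤ K →
        ∫ ω, sqError κ k₀ w Z K ω ∂μ ≤ (n * nuConst G α Δ w ^ 2 / 4) / K + r K := by
  have hu : IsUncorrelatedNoise μ Δ fun t ω => q t ω - Z t ω :=
    hq.elim (hZ.isUncorrelatedNoise hΔ) fun h => h.isUncorrelatedNoise
  obtain ⟨N, hN⟩ := G.exists_spectralNorm₂_qMatrix_pow_lt_one hG hw hα hαd
  have hZm := hZ.entriesMemLp hu.memLp
  have hEm : ∀ K, EntriesMemLp μ
      fun ω => runningAverage κ k₀ Z K ω - Matrix.vecMulVec (fun _ : Fin n => 1) w := fun K =>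
    ((((EntriesMemLp.sum _ fun k _ => hZm k).smul _).smul _).sub (entriesMemLp_const _))
  obtain ⟨D, hbound⟩ := hZ.exists_rmsNorm_runningAverage_le hG hw hα hαd hΔ hκ hu k₀
  set σ := spectralNorm₂ ((1 - G.qMatrix α w)⁻¹ * G.lap) with hσ
  set a := α * σ * (n * Δ / 2) with ha
  -- The two sides are n² and n(n + 2) times (αΔσ)²/4.
  have haν : a ^ 2 ≤ n * nuConst G α Δ w ^ 2 / 4 := by
    rw [nuConst, ← hσ, mul_pow _ σ, mul_pow _ Δ, mul_pow α, Real.sq_sqrt (by positivity), ha]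
    have : 0 ≤ (n : ℝ) * (α * Δ * σ) ^ 2 := by positivity
    nlinarith
  -- The constant and cross terms of ((D + a√K)/K)².
  set r : ℕ → ℝ := fun K => (D ^ 2 + 2 * D * a * √K) / (K : ℝ) ^ 2 with hr
  have hro : r =o[atTop] fun K : ℕ => 1 / (K : ℝ) := isLittleO_add_mul_sqrt_div_sq _ _
  have hmain : ∀ K : ℕ, 1 ≤ K →
      ∫ ω, sqError κ k₀ w Z K ω ∂μ ≤ (n * nuConst G α Δ w ^ 2 / 4) / K + r K := by
    intro K hK
    have hK0 : (0 : ℝ) < K := by exact_mod_cast hK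
    have hsq : √(K : ℝ) ^ 2 = K := Real.sq_sqrt hK0.le
    calc ∫ ω, sqError κ k₀ w Z K ω ∂μ
        = rmsNorm μ (fun ω => runningAverage κ k₀ Z K ω - Matrix.vecMulVec (fun _ : Fin n => 1) w) ^ 2 :=
          (hEm K).rmsNorm_sq.symm
      _ ≤ ((K : ℝ)⁻¹ * (D + a * √K)) ^ 2 := pow_le_pow_left₀ rmsNorm_nonneg (hbound K hK) 2
      _ = a ^ 2 / K + r K := by
          rw [mul_pow, add_sq, mul_pow a, hsq, hr]
          field_simp
          ring
      _ ≤ _ := by gcongr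
  refine ⟨isUnit_one_sub_of_spectralNorm₂_pow_lt_one hN, fun K => (hEm K).integrable_sq, ?_,
    r, hro, hmain⟩
  have hinv : Tendsto (fun K : ℕ => 1 / (K : ℝ)) atTop (nhds 0) := tendsto_one_div_atTop_nhds_zero_nat
  have hlim : Tendsto (fun K : ℕ => (n * nuConst G α Δ w ^ 2 / 4) / K + r K) atTop (nhds 0) := by
    simpa only [mul_one_div, mul_zero, add_zero] using
      (hinv.const_mul (n * nuConst G α Δ w ^ 2 / 4)).add (hro.trans_tendsto hinv)
  exact squeeze_zero' (Eventually.of_forall fun K => integral_nonneg fun ω => sq_nonneg _)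
    ((eventually_ge_atTop 1).mono hmain) hlim
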